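/- Let $\mathcal{Y}=\{-1,1\}$. For a set $\mathcal{G}$ of functions $g:\mathcal{X}\to\mathcal{X}$ (perturbations) and $h:\mathcal{X}\to\mathcal{Y}$ let $\ell_{\mathcal{G}}(h,(x,y))=\sup_{g\in\mathcal{G}}\mathbb{1}\{h(g(x))\neq y\}$ (which is $0$ if $\mathcal{G}=\emptyset$), and for a distribution $\mathcal{D}$ on $\mathcal{X}\times\mathcal{Y}$ let $R_{\mathcal{G}}(h;\mathcal{D})=\mathbb{E}_{(x,y)\sim\mathcal{D}}[\ell_{\mathcal{G}}(h,(x,y))]$. For a hypothesis class $\mathcal{H}\subset\mathcal{Y}^{\mathcal{X}}$ and a sample $S$, $\mathrm{RERM}(S;\mathcal{G})$ denotes any minimizer over $h\in\mathcal{H}$ of the empirical mean of $\ell_{\mathcal{G}}(h,\cdot)$ on $S$. If $(\mathcal{G},d)$ is a metric space with closed balls $B_r(g)=\{g'\in\mathcal{G}: d(g,g')\le r\}$ and $r\geq 0$, a subset $\mathcal{G}'\subset\mathcal{G}$ is called $r$-nice with respect to $\mathcal{H}$ if for all $x\in\mathcal{X}$, $h\in\mathcal{H}$ and $g\in\mathcal{G}'$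 there is $g^*\in\mathcal{G}$ such that $g\in B_r(g^*)$ and $h(g(x))=h(g'(x))$ for all $g'\in B_r(g^*)$. Put $\mathcal{G}'_{2r}=\bigcup_{g\in\mathcal{G}'}B_{2r}(g)$, and let $N=\mathcal{N}_r(\mathcal{G}'_{2r},d)$ be the smallest number of closed balls of radius $r$ with centres in $\mathcal{G}$ that cover $\mathcal{G}'_{2r}$. (1) There is a universal constant $C>0$ with the following property. Let $\mathcal{X}$ be a measurable space, $\mathcal{H}\subset\mathcal{Y}^{\mathcal{X}}$ a hypothesis class of finite VC dimension $\mathrm{VC}(\mathcal{H})$, $(\mathcal{G},d)$ a metric space of perturbations, and $\mathcal{G}'\subset\mathcal{G}$ a subset that is $r$-nice with respect to $\mathcal{H}$ and for which $N<\infty$. Then for every learning rule $\mathcal{A}(S)=\mathrm{RERM}(S;\mathcal{G})$, every probability distribution $\mathcal{D}$ on $\mathcal{X}\times\mathcal{Y}$ that satisfies the measurability conditions below, all $\varepsilon>0$ and $\delta\in(0,1)$, and every $$n\;\ge\; C\,\frac{\mathrm{VC}(\mathcal{H})\,\log(\max\{N,2\})+\ln(1/\delta)}{\varepsilon^2},$$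 with probability at least $1-\delta$ over a sample $S\sim\mathcal{D}^n$, $$R_{\mathcal{G}'}(\mathcal{A}(S);\mathcal{D})\;\le\;\inf_{h\in\mathcal{H}}R_{\mathcal{G}}(h;\mathcal{D})+\varepsilon .$$ Measurability conditions, up to null sets of $\mathcal{D}$ and $\mathcal{D}^n$: for $h\in\mathcal{H}$ and $g\in\mathcal{G}$, the losses $\ell_{\mathcal{G}}(h,\cdot)$ and $\ell_{\mathcal{G}'}(h,\cdot)$ and the function $(x,y)\mapsto h(g(x))$ are measurable; and for all $n,k$, all $g_1,\dots,g_k\in\mathcal{G}$ and all $b\in\mathcal{Y}^{n\times k}$, the set of samples $((x_i,y_i))_{i\le n}$ for which some $h\in\mathcal{H}$ satisfies $h(g_j(x_i))=b_{ij}$ for all $i,j$ is measurable. (2) $\ell_p$ balls are $r$-nice for halfspaces: let $1\le p\le\infty$, $\mathcal{X}=\mathbb{R}^q$, $r\ge 0$, and let $\mathcal{H}=\{x\mapsto\mathrm{sign}(w^{T}x): w\in\mathbb{R}^q\}$, where $\mathrm{sign}(0)$ is fixed as either of the two labels. Let $\mathcal{G}$ be any set of functions $\mathbb{R}^q\to\mathbb{R}^q$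 that contains all translations $x\mapsto x+\tau$ with $\|\tau\|_p\le 3r$ and on which $d(g,g')=\sup_{x}\|g(x)-g'(x)\|_p$ is finite, and hence a metric. Then $\mathcal{G}'=\{x\mapsto x+\tau : \|\tau\|_p\le r\}$ is $r$-nice with respect to $\mathcal{H}$ in $(\mathcal{G},d)$. -/

import Mathlib

open MeasureTheory
open scoped ENNReal NNReal

universe u

noncomputable section

namespace TolerantRobust

/-- The label space `{-1, 1}`, encoded by `false` for `-1` and `true` for `1`. -/
abbrev Label : Type := Bool

/-- `H` shatters the finite set `s`: every labelling of `s` is realised by a member of `H`. -/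
def Shatters {X : Type u} (H : Set (X → Label)) (s : Finset X) : Prop :=
  ∀ y : X → Label, ∃ h ∈ H, ∀ x ∈ s, h x = y x

/-- The VC dimension of `H`: the largest size of a shattered set (`⊤` if there is no largest). -/
def vcDim {X : Type u} (H : Set (X → Label)) : ℕ∞ :=
  ⨆ (s : Finset X) (_ : Shatters H s), (s.card : ℕ∞)

/-- The adversarially robust loss `sup_{g ∈ G} 1{h (g x) ≠ y}` (equal to `0` if `G` is empty). -/
def robustLoss {X : Type u} (G : Set (X → X)) (h : X → Label) (z : X × Label) : ℝ :=
  ⨆ g : G, if h (g.1 z.1) ≠ z.2 then (1 : ℝ) else 0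

/-- The adversarially robust risk: the expectation of the robust loss under `D`. -/
def robustRisk {X : Type u} [MeasurableSpace X] (G : Set (X → X)) (h : X → Label)
    (D : Measure (X × Label)) : ℝ :=
  ∫ z, robustLoss G h z ∂D

/-- The empirical robust risk of `h` on the sample `S`. -/
def empiricalRobustRisk {X : Type u} {n : ℕ} (G : Set (X → X)) (h : X → Label)
    (S : Fin n → X × Label) : ℝ :=
  (∑ i, robustLoss G h (S i)) / n

/-- The set of robust empirical risk minimizers in `H` on the sample `S`. -/
def RERM {X : Type u} {n : ℕ} (H : Set (X → Label)) (G : Set (X → X))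
    (S : Fin n → X × Label) : Set (X → Label) :=
  {h | h ∈ H ∧ ∀ h' ∈ H, empiricalRobustRisk G h S ≤ empiricalRobustRisk G h' S}

/-- A learning rule, that maps samples of every size to predictors, is a RERM rule if it always
outputs a robust empirical risk minimizer in `H`. -/
def IsRERMRule {X : Type u} (H : Set (X → Label)) (G : Set (X → X))
    (A : (n : ℕ) → (Fin n → X × Label) → X → Label) : Prop :=
  ∀ (n : ℕ) (S : Fin n → X × Label), A n S ∈ RERM H G S

/-- `G'` is `r`-nice with respect to `H` in the metric space `G` of perturbation functions. -/
def IsNice {X : Type u} {G : Set (X → X)} [MetricSpace G] (r : ℝ≥0) (H : Set (X → Label))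
    (G' : Set G) : Prop :=
  ∀ x : X, ∀ h ∈ H, ∀ g ∈ G', ∃ gs : G, g ∈ Metric.closedBall gs (r : ℝ) ∧
    ∀ g' ∈ Metric.closedBall gs (r : ℝ), h (g.1 x) = h (g'.1 x)

/-- The union of the closed balls of radius `2 r` with centres in `G'`. -/
def enlargement {X : Type u} {G : Set (X → X)} [MetricSpace G] (r : ℝ≥0) (G' : Set G) : Set G :=
  ⋃ g ∈ G', Metric.closedBall g (2 * (r : ℝ))

/-- The measurability that is implicit in speaking of risks and of uniform deviations over `H`
under the distribution `D`. Without the last field the behaviour of an empirical risk minimizer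
is not controlled by the VC dimension; that field holds for instance if the perturbed hypotheses
are measurable and `H` is countable, or if the perturbations are measurable and `H` has a jointly
measurable standard Borel parametrization. -/
structure RiskMeasurable {X : Type u} [MeasurableSpace X] (H : Set (X → Label))
    (G : Set (X → X)) (G' : Set G) (D : Measure (X × Label)) : Prop where
  /-- The robust loss with respect to `G` of each hypothesis is measurable. -/
  loss_large : ∀ h ∈ H, AEMeasurable (robustLoss G h) D
  /-- The robust loss with respect to `G'` of each hypothesis is measurable. -/
  loss_small : ∀ h ∈ H, AEMeasurable (robustLoss (Subtype.val '' G') h) D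
  /-- Each perturbed hypothesis is measurable. -/
  perturbed : ∀ h ∈ H, ∀ g ∈ G, AEMeasurable (fun z : X × Label => h (g z.1)) D
  /-- For finitely many perturbations and a sample of any size, the event that a given pattern of
  labels on the perturbed sample is realised by some member of `H` is measurable. -/
  pattern : ∀ (n k : ℕ) (g : Fin k → G) (b : Fin n → Fin k → Label),
    NullMeasurableSet
      {S : Fin n → X × Label | ∃ h ∈ H, ∀ i j, h ((g j).1 (S i).1) = b i j}
      (Measure.pi fun _ : Fin n => D)

/-- The space `ℝ^q` with the `ℓ_p` norm. -/
abbrev LpSpace (p : ℝ≥0∞) (q : ℕ) : Type := PiLp p (fun _ : Fin q => ℝ)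

/-- The label that the homogeneous halfspace with normal vector `w` gives to `x`, i.e. the sign of
`w ⬝ x`, where the sign of `0` is taken to be `b`. -/
def halfspace (p : ℝ≥0∞) (q : ℕ) (b : Label) (w : Fin q → ℝ) (x : LpSpace p q) : Label :=
  if 0 < ∑ i, w i * x i then true else if ∑ i, w i * x i < 0 then false else b

/-- The class of all homogeneous halfspaces of `ℝ^q`. -/
def halfspaces (p : ℝ≥0∞) (q : ℕ) (b : Label) : Set (LpSpace p q → Label) :=
  Set.range (halfspace p q b)

/-- The translations `x ↦ x + τ` with `‖τ‖_p ≤ ρ`, which map `x` onto the `ℓ_p` ball of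
radius `ρ` around `x`. -/
def translations (p : ℝ≥0∞) [Fact (1 ≤ p)] (q : ℕ) (ρ : ℝ) : Set (LpSpace p q → LpSpace p q) :=
  {g | ∃ τ : LpSpace p q, ‖τ‖ ≤ ρ ∧ g = fun x => x + τ}

end TolerantRobust

end

/-! For (1), cover the enlargement by `k ≤ N` balls of radius `r` with centres `g j`, and compare
both robust losses with `anyErrorLoss`, the loss over these finitely many centres. It lies below the
loss over `G`, and by niceness above the loss over `G'` (`IsNice.robustLoss_le_anyErrorLoss`). A
one-sided uniform deviation bound for this intermediate loss therefore controls the risk over `G'`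
by the empirical risk over `G`, which RERM minimizes. Against a fixed near-optimal competitor,
Hoeffding's inequality is enough.

The intermediate loss at one example depends on `k` values of `h`, so `m` examples involve at most
`m * k` points and Sauer–Shelah bounds the number of loss vectors (`hasGrowth_anyError`). The
deviation bound (`measure_exists_deviation_le`) comes from a ghost sample, random swaps between the
two samples, and chaining over Hamming nets (`HasGrowth.card_signedDiff_le`). A plain union bound
over all loss vectors would cost an extra logarithm of the sample size; chaining with
dimension-dependent nets gives the rate `d log N / ε ^ 2`.

For (2), shift the centre of the ball by the vector of norm at most `r` that moves farthest away
from the hyperplane. The whole ball then stays on the side of the given point. -/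

namespace TolerantRobust

/-! ### Sauer–Shelah, packing in Hamming distance, Rademacher tails. -/

/-- **Sauer–Shelah** in exponential form. -/
lemma card_mul_pow_le_exp {X : Type u} {H : Set (X → Label)} {d : ℕ}
    (hd : ∀ s : Finset X, Shatters H s → s.card ≤ d) (A : Finset X)
    (F : Finset (X → Label)) (hF : ∀ f ∈ F, f ∈ H)
    (hinj : ∀ f ∈ F, ∀ g ∈ F, (∀ x ∈ A, f x = g x) → f = g) {t : ℝ} (ht : 0 < t) (ht1 : t ≤ 1) :
    (F.card : ℝ) * t ^ d ≤ Real.exp (t * A.card) := by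
  classical
  set 𝒜 : Finset (Finset X) := F.image (fun f => A.filter (fun x => f x = true)) with h𝒜
  have hcard : 𝒜.card = F.card := by
    refine Finset.card_image_of_injOn ?_
    intro f hf g hg hfg
    refine hinj f hf g hg fun x hx => ?_
    have := congrArg (fun s => x ∈ s) hfg
    simp only [Finset.mem_filter, hx, true_and, eq_iff_iff] at this
    exact Bool.eq_iff_iff.2 this
  have hsub : ∀ s ∈ 𝒜.shatterer, s ∈ A.powerset ∧ s.card ≤ d := by
    intro s hs
    rw [Finset.mem_shatterer] at hs
    refine ⟨?_, hd s ?_⟩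
    · obtain ⟨u, hu, hsu⟩ := hs.exists_superset
      obtain ⟨f, -, rfl⟩ := Finset.mem_image.1 hu
      exact Finset.mem_powerset.2 (hsu.trans (Finset.filter_subset _ _))
    · intro y
      obtain ⟨v, hv, hsv⟩ := hs.exists_superset
      obtain ⟨f', -, rfl⟩ := Finset.mem_image.1 hv
      obtain ⟨u, hu, hsu⟩ := hs (Finset.filter_subset (fun x => y x = true) s)
      obtain ⟨f, hf, rfl⟩ := Finset.mem_image.1 hu
      refine ⟨f, hF f hf, fun x hx => ?_⟩
      have hxA : x ∈ A := (Finset.mem_filter.1 (hsv hx)).1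
      have := congrArg (fun s => x ∈ s) hsu
      simp only [Finset.mem_filter, Finset.mem_inter, hx, hxA, true_and, eq_iff_iff] at this
      exact Bool.eq_iff_iff.2 this
  -- Pajor's inequality: a family has at most as many members as shattered sets. Weighting a
  -- shattered set `s` by `t ^ s.card ≥ t ^ d` allows the sum to run over all subsets of `A`, where
  -- the binomial theorem applies.
  calc (F.card : ℝ) * t ^ d ≤ (𝒜.shatterer.card : ℝ) * t ^ d := by
        rw [← hcard]
        exact mul_le_mul_of_nonneg_right
          (by exact_mod_cast Finset.card_le_card_shatterer 𝒜) (by positivity)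
    _ = ∑ s ∈ 𝒜.shatterer, t ^ d := by simp
    _ ≤ ∑ s ∈ 𝒜.shatterer, t ^ s.card :=
        Finset.sum_le_sum fun s hs => pow_le_pow_of_le_one ht.le ht1 (hsub s hs).2
    _ ≤ ∑ s ∈ A.powerset, t ^ s.card :=
        Finset.sum_le_sum_of_subset_of_nonneg (fun s hs => (hsub s hs).1)
          fun _ _ _ => by positivity
    _ = (t + 1) ^ A.card := by
        rw [← Finset.sum_pow_mul_eq_add_pow]; simp
    _ ≤ Real.exp t ^ A.card := by gcongr; exact Real.add_one_le_exp t
    _ = Real.exp (t * A.card) := by rw [← Real.exp_nat_mul, mul_comm]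

/-- The class `T` of binary vectors satisfies the growth bound of a class of VC dimension `d`
in which every coordinate is a function of `N` labels. -/
def HasGrowth {I : Type*} (T : Set (I → Bool)) (d : ℕ) (N : ℝ) : Prop :=
  ∀ (k : ℕ) (τ : Fin k → I) (T' : Finset (I → Bool)), (∀ f ∈ T', f ∈ T) →
    Set.InjOn (fun f : I → Bool => f ∘ τ) T' →
    ∀ t : ℝ, 0 < t → t ≤ 1 → (T'.card : ℝ) * t ^ d ≤ Real.exp (t * (k * N))

/-- A family of well separated binary vectors is already separated by few coordinates. -/
lemma exists_injOn_comp {I : Type*} [Fintype I] [Nonempty I] (T : Finset (I → Bool))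
    {ε : ℝ} (hsep : ∀ f ∈ T, ∀ g ∈ T, f ≠ g → ε * Fintype.card I < hammingDist f g)
    (k : ℕ) (hT : 0 < T.card) (hk : 2 * Real.log T.card ≤ ε * k) :
    ∃ τ : Fin k → I, Set.InjOn (fun f : I → Bool => f ∘ τ) T := by
  classical
  set m : ℝ := (Fintype.card I : ℝ) with hm
  have hmpos : 0 < m := by simp [hm, Fintype.card_pos]
  -- Probabilistic method by counting: a random `k`-tuple of coordinates misses the difference of a
  -- given pair with probability at most `exp (-ε k)`, and a union bound runs over all pairs.
  by_contra! hno
  have hcov : (Finset.univ : Finset (Fin k → I)) ⊆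
      T.offDiag.biUnion fun p => Fintype.piFinset fun _ : Fin k =>
        Finset.univ.filter fun i => p.1 i = p.2 i := by
    intro τ _
    have := hno τ
    simp only [Set.InjOn, not_forall] at this
    obtain ⟨f, hf, g, hg, hfg, hne⟩ := this
    refine Finset.mem_biUnion.2 ⟨(f, g), Finset.mem_offDiag.2 ⟨hf, hg, hne⟩, ?_⟩
    rw [Fintype.mem_piFinset]
    intro l
    simpa using congrFun hfg l
  have hpair : ∀ p ∈ T.offDiag, ((Fintype.piFinset fun _ : Fin k =>
      Finset.univ.filter fun i => p.1 i = p.2 i).card : ℝ) ≤ m ^ k * Real.exp (-(ε * k)) := by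
    intro p hp
    obtain ⟨h1, h2, h3⟩ := Finset.mem_offDiag.1 hp
    have hs := hsep _ h1 _ h2 h3
    rw [Fintype.card_piFinset]
    simp only [Finset.prod_const, Finset.card_univ, Fintype.card_fin]
    have hsum : ((Finset.univ.filter fun i => p.1 i = p.2 i).card : ℝ) + hammingDist p.1 p.2
        = m := by
      rw [hm, hammingDist, ← Nat.cast_add, Finset.card_filter_add_card_filter_not]
      rfl
    have hle : ((Finset.univ.filter fun i => p.1 i = p.2 i).card : ℝ) ≤ m * Real.exp (-ε) := by
      have := Real.add_one_le_exp (-ε)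
      nlinarith
    push_cast
    calc _ ≤ (m * Real.exp (-ε)) ^ k := by gcongr
      _ = _ := by rw [mul_pow, ← Real.exp_nat_mul]; ring_nf
  have h1 : m ^ k ≤ (T.offDiag.card : ℝ) * (m ^ k * Real.exp (-(ε * k))) := by
    calc m ^ k = ((Finset.univ : Finset (Fin k → I)).card : ℝ) := by simp [hm]
      _ ≤ ((T.offDiag.biUnion fun p => Fintype.piFinset fun _ : Fin k =>
        Finset.univ.filter fun i => p.1 i = p.2 i).card : ℝ) := by
          exact_mod_cast Finset.card_le_card hcov
      _ ≤ ∑ p ∈ T.offDiag, ((Fintype.piFinset fun _ : Fin k =>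
        Finset.univ.filter fun i => p.1 i = p.2 i).card : ℝ) := by
          exact_mod_cast Finset.card_biUnion_le
      _ ≤ _ := by
          refine (Finset.sum_le_sum hpair).trans ?_
          simp
  have hM : (0 : ℝ) < T.card := by exact_mod_cast hT
  -- Discarding the diagonal makes this strict, so the non-strict hypothesis on `k` suffices.
  have h2 : (T.offDiag.card : ℝ) < (T.card : ℝ) ^ 2 := by
    rw [Finset.offDiag_card, Nat.cast_sub (Nat.le_mul_self _)]
    push_cast
    nlinarith
  have h3 : Real.exp (-(ε * k)) * (T.card : ℝ) ^ 2 ≤ 1 := by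
    rw [← Real.exp_log (pow_pos hM 2), ← Real.exp_add, Real.log_pow]
    rw [← Real.exp_zero]
    apply Real.exp_le_exp.2
    push_cast
    linarith
  have h4 : (T.offDiag.card : ℝ) * Real.exp (-(ε * k)) < 1 := by
    nlinarith [Real.exp_pos (-(ε * k))]
  have h5 : 0 < m ^ k := by positivity
  nlinarith

/-- **Packing bound** for separated families in a class of polynomial growth. -/
lemma HasGrowth.log_card_le {I : Type*} [Fintype I] [Nonempty I] {T : Set (I → Bool)} {d : ℕ}
    {N : ℝ} (hT : HasGrowth T d N) (hN : 1 ≤ N) {ε : ℝ} (hε : 0 < ε) (hε1 : ε ≤ 1)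
    (T' : Finset (I → Bool)) (hT' : ∀ f ∈ T', f ∈ T) (hne : 0 < T'.card)
    (hsep : ∀ f ∈ T', ∀ g ∈ T', f ≠ g → ε * Fintype.card I < hammingDist f g) :
    Real.log T'.card ≤ 2 * d * Real.log (4 * N / ε) + 1 / 2 := by
  set M : ℝ := (T'.card : ℝ)
  have hM : 1 ≤ M := Nat.one_le_cast.2 hne
  have hlog : 0 ≤ Real.log M := Real.log_nonneg hM
  obtain ⟨k, hk1, hk⟩ : ∃ k : ℕ, 2 * Real.log M / ε ≤ k ∧ (k : ℝ) < 2 * Real.log M / ε + 1 :=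
    ⟨_, Nat.le_ceil _, Nat.ceil_lt_add_one (by positivity)⟩
  obtain ⟨τ, hτ⟩ := exists_injOn_comp T' hsep k hne (by
    rw [div_le_iff₀ hε] at hk1
    linarith)
  have hk' : ε * k ≤ 2 * Real.log M + ε := by
    have : ε * k ≤ ε * (2 * Real.log M / ε + 1) := by gcongr
    rwa [mul_add, mul_div_cancel₀ _ hε.ne', mul_one] at this
  -- With `t = ε / (4 N)` the exponent `t k N = ε k / 4` is at most `log M / 2 + 1 / 4`. Half of
  -- `log M` can thus be absorbed on the left, and no logarithm of `log M` appears.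
  have htpos : 0 < ε / (4 * N) := by positivity
  have h := hT k τ T' hT' hτ (ε / (4 * N)) htpos (by
    rw [div_le_one (by positivity)]; linarith)
  have h2 := Real.log_le_log (by positivity) h
  rw [Real.log_exp, Real.log_mul (by positivity) (by positivity), Real.log_pow] at h2
  have h3 : ε / (4 * N) * (k * N) = ε * k / 4 := by field_simp
  have h4 : Real.log (4 * N / ε) = - Real.log (ε / (4 * N)) := by
    rw [← Real.log_inv, inv_div]
  rw [h3] at h2
  rw [h4]
  change Real.log M + _ ≤ _ at h2
  nlinarith

/-- Tail bound for **Rademacher sums**. -/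
lemma card_rademacher_tail_le {n : ℕ} (a : Fin n → ℝ) {V s : ℝ} (hV : 0 < V)
    (ha : ∑ i, a i ^ 2 ≤ V) (hs : 0 ≤ s) :
    ((Finset.univ.filter fun σ : Fin n → Bool =>
      s ≤ ∑ i, (if σ i then a i else -a i)).card : ℝ) ≤ 2 ^ n * Real.exp (-(s ^ 2 / (2 * V))) := by
  -- The Chernoff parameter that minimizes `-l s + l ^ 2 V / 2`.
  set l := s / V with hl
  have hl0 : 0 ≤ l := by positivity
  have h1 : ((Finset.univ.filter fun σ : Fin n → Bool =>
      s ≤ ∑ i, (if σ i then a i else -a i)).card : ℝ) ≤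
      ∑ σ : Fin n → Bool, Real.exp (-(l * s)) * ∏ i, Real.exp (l * (if σ i then a i else -a i)) := by
    rw [Finset.card_filter]
    push_cast
    refine Finset.sum_le_sum fun σ _ => ?_
    rw [← Real.exp_sum, ← Real.exp_add, ← Finset.mul_sum]
    split_ifs with h
    · apply Real.one_le_exp
      nlinarith
    · positivity
  refine h1.trans ?_
  rw [← Finset.mul_sum]
  have h2 : ∑ σ : Fin n → Bool, ∏ i, Real.exp (l * (if σ i then a i else -a i)) =
      ∏ i, (2 * Real.cosh (l * a i)) := by
    have := (Finset.prod_univ_sum (fun _ : Fin n => (Finset.univ : Finset Bool))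
      (fun i b => Real.exp (l * (if b then a i else -a i)))).symm
    rw [Fintype.piFinset_univ] at this
    rw [this]
    refine Finset.prod_congr rfl fun i _ => ?_
    simp [Real.cosh_eq]
    ring
  rw [h2, Finset.prod_mul_distrib]
  have h3 : ∏ i, Real.cosh (l * a i) ≤ Real.exp (l ^ 2 * V / 2) := by
    calc ∏ i, Real.cosh (l * a i) ≤ ∏ i, Real.exp ((l * a i) ^ 2 / 2) :=
          Finset.prod_le_prod (fun i _ => (Real.cosh_pos _).le)
            fun i _ => Real.cosh_le_exp_half_sq _
      _ = Real.exp (l ^ 2 * (∑ i, a i ^ 2) / 2) := by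
          rw [← Real.exp_sum, Finset.mul_sum, Finset.sum_div]
          congr 1
          refine Finset.sum_congr rfl fun i _ => by ring
      _ ≤ _ := by gcongr
  simp only [Finset.prod_const, Finset.card_univ, Fintype.card_fin]
  calc _ ≤ Real.exp (-(l * s)) * (2 ^ n * Real.exp (l ^ 2 * V / 2)) := by gcongr
    _ = 2 ^ n * (Real.exp (-(l * s)) * Real.exp (l ^ 2 * V / 2)) := by ring
    _ = _ := by
        rw [← Real.exp_add]
        congr 2
        rw [hl]; field_simp; ring

/-! ### Niceness of translations for halfspaces. -/

/-- Translations by vectors in an `ℓ_p` ball are nice for homogeneous halfspaces. -/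
lemma isNice_translations (p : ℝ≥0∞) [Fact (1 ≤ p)] (q : ℕ) (b : Label) (r : ℝ≥0)
    (G : Set (LpSpace p q → LpSpace p q)) [MetricSpace G]
    (hG : translations p q (3 * r) ⊆ G)
    (hdist : ∀ g g' : G, IsLUB (Set.range fun x => ‖g.1 x - g'.1 x‖) (dist g g')) :
    IsNice r (halfspaces p q b) {g : G | g.1 ∈ translations p q r} := by
  rintro x _ ⟨w, rfl⟩ g ⟨τ, hτ, hg⟩
  let L : LpSpace p q → ℝ := fun u => ∑ i, w i * u i
  have hLc : Continuous L := by fun_prop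
  have hLadd : ∀ u v, L (u + v) = L u + L v := fun u v => by
    simp [L, mul_add, Finset.sum_add_distrib]
  have hLneg : ∀ u, L (-u) = - L u := fun u => by simp [L]
  -- Compactness gives a maximizer of the linear form on the ball, uniformly in `p` and without
  -- computing the dual norm.
  obtain ⟨v, hv, hmax⟩ := (isCompact_closedBall (0 : LpSpace p q) r).exists_isMaxOn
    ⟨0, by simp⟩ hLc.continuousOn
  have hvr : ‖v‖ ≤ r := by simpa using hv
  have hmax' : ∀ u : LpSpace p q, ‖u‖ ≤ r → L u ≤ L v := fun u hu => hmax (by simpa using hu)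
  have hmin' : ∀ u : LpSpace p q, ‖u‖ ≤ r → -L v ≤ L u := fun u hu => by
    have := hmax' (-u) (by simpa using hu)
    rw [hLneg] at this
    linarith
  -- moving the centre by `e = ±v` keeps the whole ball on one side
  have key : ∀ e : LpSpace p q, ‖e‖ ≤ r →
      (∀ u : LpSpace p q, ‖u‖ ≤ r → halfspace p q b w (x + τ) =
        halfspace p q b w (x + τ + e + u)) →
      ∃ gs : G, g ∈ Metric.closedBall gs (r : ℝ) ∧ ∀ g' ∈ Metric.closedBall gs (r : ℝ),
        halfspace p q b w (g.1 x) = halfspace p q b w (g'.1 x) := by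
    intro e he hconst
    -- The new centre is a translation of norm at most `2 r`.
    have hmem : (fun y => y + (τ + e)) ∈ G := hG ⟨τ + e, by
      have := norm_add_le τ e
      have hr : (0 : ℝ) ≤ r := r.2
      linarith, rfl⟩
    refine ⟨⟨_, hmem⟩, ?_, ?_⟩
    · rw [Metric.mem_closedBall]
      refine (hdist _ _).2 ?_
      rintro _ ⟨y, rfl⟩
      have : g.1 y - (y + (τ + e)) = -e := by simp only [hg]; abel
      simpa [this] using he
    · intro g' hg'
      have h1 : ‖g'.1 x - (x + (τ + e))‖ ≤ r :=
        ((hdist g' ⟨_, hmem⟩).1 ⟨x, rfl⟩).trans (Metric.mem_closedBall.1 hg')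
      have h2 := hconst _ h1
      rw [hg]
      convert h2 using 2
      abel
  have hval : ∀ y, halfspace p q b w y = if 0 < L y then true else if L y < 0 then false else b :=
    fun y => rfl
  rcases lt_trichotomy (L (x + τ)) 0 with h | h | h
  · refine key (-v) (by simpa using hvr) fun u hu => ?_
    have := hmax' u hu
    have h1 : L (x + τ + -v + u) < 0 := by
      rw [hLadd, hLadd, hLneg]; linarith
    simp [hval, h, h1, h.not_gt, h1.not_gt]
  -- On the hyperplane the shift goes to the side labelled `b`: the closed halfspace on that side
  -- has constant label `b`, so touching the hyperplane again does no harm.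
  · cases b with
    | false =>
      refine key (-v) (by simpa using hvr) fun u hu => ?_
      have := hmax' u hu
      have h1 : L (x + τ + -v + u) ≤ 0 := by
        rw [hLadd, hLadd, hLneg]; linarith
      simp [hval, h, h1]
    | true =>
      refine key v hvr fun u hu => ?_
      have := hmin' u hu
      have h1 : 0 ≤ L (x + τ + v + u) := by
        rw [hLadd, hLadd]; linarith
      simp [hval, h, h1.not_gt]
  · refine key v hvr fun u hu => ?_
    have := hmin' u hu
    have h1 : 0 < L (x + τ + v + u) := by
      rw [hLadd, hLadd]; linarith
    simp [hval, h, h1]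

/-! ### Hamming nets and chaining. -/

/-- Covering bound for a class of polynomial growth. -/
lemma HasGrowth.exists_net {I : Type*} [Fintype I] [Nonempty I] {T : Set (I → Bool)} {d : ℕ}
    {N : ℝ} (hT : HasGrowth T d N) (hN : 1 ≤ N) {ε : ℝ} (hε : 0 < ε) (hε1 : ε ≤ 1) :
    ∃ T' : Finset (I → Bool),
      (T'.card : ℝ) ≤ Real.exp (2 * d * Real.log (4 * N / ε) + 1 / 2) ∧
      ∀ f ∈ T, ∃ g ∈ T', (hammingDist f g : ℝ) ≤ ε * Fintype.card I := by
  classical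
  let P : Finset (I → Bool) → Prop := fun S => (∀ f ∈ S, f ∈ T) ∧
    ∀ f ∈ S, ∀ g ∈ S, f ≠ g → ε * Fintype.card I < hammingDist f g
  -- A separated family of maximal size is a net, since an uncovered vector could be added to it.
  obtain ⟨T', hT', hmax⟩ := Finset.exists_max_image
    ((Finset.univ : Finset (Finset (I → Bool))).filter P) Finset.card
    ⟨∅, by simp [P]⟩
  have hP : P T' := (Finset.mem_filter.1 hT').2
  refine ⟨T', ?_, fun f hf => ?_⟩
  · rcases Nat.eq_zero_or_pos T'.card with h0 | h0
    · rw [h0, Nat.cast_zero]; positivity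
    · rw [← Real.log_le_iff_le_exp (by exact_mod_cast h0)]
      exact hT.log_card_le hN hε hε1 T' hP.1 h0 hP.2
  · by_contra! hno
    have hfT : f ∉ T' := fun h => by
      have := hno f h
      rw [hammingDist_self, Nat.cast_zero] at this
      exact absurd this (not_lt.2 (by positivity))
    have hins : P (insert f T') := by
      refine ⟨fun g hg => ?_, fun g hg g' hg' hne => ?_⟩
      · rcases Finset.mem_insert.1 hg with rfl | hg
        · exact hf
        · exact hP.1 g hg
      · rcases Finset.mem_insert.1 hg with rfl | h1 <;>
          rcases Finset.mem_insert.1 hg' with rfl | h2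
        · exact absurd rfl hne
        · exact hno _ h2
        · rw [hammingDist_comm]; exact hno _ h1
        · exact hP.2 g h1 g' h2 hne
    have := hmax _ (Finset.mem_filter.2 ⟨Finset.mem_univ _, hins⟩)
    rw [Finset.card_insert_of_notMem hfT] at this
    omega

/-- The difference of the two halves of a binary vector at the coordinate `i`. -/
def halfDiff {n : ℕ} (f : Fin n ⊕ Fin n → Bool) (i : Fin n) : ℝ :=
  (if f (.inr i) then 1 else 0) - (if f (.inl i) then 1 else 0)

/-- The signed sum of the differences of the two halves of a binary vector. -/
def signedDiff {n : ℕ} (σ : Fin n → Bool) (f : Fin n ⊕ Fin n → Bool) : ℝ :=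
  ∑ i, if σ i then halfDiff f i else -halfDiff f i

/-- Turns Hamming distance into the variance proxy of a Rademacher sum, by `(a - b) ^ 2 ≤ 2 (a ^ 2 +
b ^ 2)` with `a`, `b` the changes in the two halves. -/
lemma sum_sq_halfDiff_sub_le {n : ℕ} (f g : Fin n ⊕ Fin n → Bool) :
    ∑ i, (halfDiff f i - halfDiff g i) ^ 2 ≤ 2 * hammingDist f g := by
  rw [hammingDist, Finset.card_filter]
  push_cast
  rw [Fintype.sum_sum_type, ← Finset.sum_add_distrib, Finset.mul_sum]
  refine Finset.sum_le_sum fun i _ => ?_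
  unfold halfDiff
  cases f (.inl i) <;> cases f (.inr i) <;> cases g (.inl i) <;> cases g (.inr i) <;> norm_num

lemma signedDiff_sub {n : ℕ} (σ : Fin n → Bool) (f g : Fin n ⊕ Fin n → Bool) :
    signedDiff σ f - signedDiff σ g =
      ∑ i, if σ i then halfDiff f i - halfDiff g i else -(halfDiff f i - halfDiff g i) := by
  rw [signedDiff, signedDiff, ← Finset.sum_sub_distrib]
  refine Finset.sum_congr rfl fun i _ => ?_
  split_ifs <;> ring

/-- Tail bound for one link of a chain. -/
lemma card_link_le {n : ℕ} (hn : 0 < n) {τ : ℝ} (hτ : 0 < τ) (j : ℕ)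
    (f g : Fin n ⊕ Fin n → Bool) (hfg : (hammingDist f g : ℝ) ≤ 6 * n * (1 / 2) ^ (j + 1)) :
    ((Finset.univ.filter fun σ : Fin n → Bool =>
      n * (τ / 3 * (3 / 4) ^ (j + 1)) ≤ signedDiff σ f - signedDiff σ g).card : ℝ) ≤
      2 ^ n * Real.exp (-(n * τ ^ 2 / 1728 * (j + 2))) := by
  have hn' : (0 : ℝ) < n := by exact_mod_cast hn
  have hV : 0 < 12 * n * (1 / 2 : ℝ) ^ (j + 1) := by positivity
  have h := card_rademacher_tail_le (fun i => halfDiff f i - halfDiff g i)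
    (s := n * (τ / 3 * (3 / 4) ^ (j + 1))) hV
    ((sum_sq_halfDiff_sub_le f g).trans (by linarith)) (by positivity)
  simp only [signedDiff_sub]
  refine h.trans ?_
  gcongr
  -- Thresholds decay like `(3/4) ^ j` and variances like `(1/2) ^ j`, so the exponent grows like
  -- `(9/8) ^ j`. Bernoulli's inequality keeps a linear part `(j + 2) / 8`, whence `1728 = 8 * 216`.
  have hb : 1 + ((j + 1 : ℕ) : ℝ) * (1 / 8) ≤ (1 + 1 / 8) ^ (j + 1) :=
    one_add_mul_le_pow (by norm_num) _
  have he : (n * (τ / 3 * (3 / 4) ^ (j + 1))) ^ 2 / (2 * (12 * n * (1 / 2 : ℝ) ^ (j + 1))) =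
      n * τ ^ 2 / 216 * (1 + 1 / 8) ^ (j + 1) := by
    have h98 : ((1 : ℝ) + 1 / 8) ^ (j + 1) = ((3 / 4) ^ (j + 1)) ^ 2 / (1 / 2) ^ (j + 1) := by
      rw [← pow_mul, mul_comm (j + 1) 2, pow_mul, ← div_pow]; norm_num
    rw [h98]
    field_simp
    ring
  rw [he]
  have hA : 0 ≤ n * τ ^ 2 / 216 := by positivity
  push_cast at hb
  nlinarith

/-- **Chaining**: for most choices of signs no member of a class of polynomial growth has a large
signed sum. -/
lemma HasGrowth.card_signedDiff_le {n : ℕ} (hn : 0 < n) {T : Set (Fin n ⊕ Fin n → Bool)} {d : ℕ}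
    (hd : 1 ≤ d) {N : ℝ} (hT : HasGrowth T d N) (hN : 2 ≤ N) {τ δ : ℝ} (hτ : 0 < τ)
    (hδ : 0 < δ) (hδ1 : δ < 1)
    (hnτ : 8 * (d * Real.log N) + Real.log (4 / δ) ≤ n * τ ^ 2 / 1728) (B : Finset (Fin n → Bool))
    (hB : ∀ σ ∈ B, ∃ f ∈ T, n * τ < signedDiff σ f) :
    (B.card : ℝ) ≤ 2 ^ n * (δ / 4) := by
  classical
  have : Nonempty (Fin n) := ⟨⟨0, hn⟩⟩
  have hn' : (0 : ℝ) < n := by exact_mod_cast hn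
  have hcardI : (Fintype.card (Fin n ⊕ Fin n) : ℝ) = 2 * n := by
    simp; ring
  set L := d * Real.log N with hL
  have hlog2 : Real.log 2 ≤ Real.log N := Real.log_le_log (by norm_num) hN
  have hl2 := Real.log_two_gt_d9
  have hd' : (1 : ℝ) ≤ d := by exact_mod_cast hd
  have hLhalf : 1 / 2 ≤ L := by nlinarith
  -- The scale is halved at each level. The coarsest net is the zero vector, whose signed sum
  -- vanishes, so that the chain starts at `0`. `L ≥ 1 / 2` absorbs the additive `1 / 2` of the
  -- covering bound.
  have hnet : ∀ j : ℕ, ∃ T' : Finset (Fin n ⊕ Fin n → Bool),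
      (T'.card : ℝ) ≤ Real.exp ((7 + 2 * j) * L) ∧
      (∀ f ∈ T, ∃ g ∈ T', (hammingDist f g : ℝ) ≤ 2 * n * (1 / 2) ^ j) ∧
      (j = 0 → T' = {fun _ => false}) := by
    intro j
    rcases Nat.eq_zero_or_pos j with rfl | hj
    · refine ⟨{fun _ => false}, ?_, fun f _ => ⟨_, Finset.mem_singleton_self _, ?_⟩, fun _ => rfl⟩
      · simp only [Finset.card_singleton, Nat.cast_one]
        apply Real.one_le_exp; push_cast; nlinarith
      · rw [pow_zero, mul_one, ← hcardI]
        exact_mod_cast hammingDist_le_card_fintype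
    · obtain ⟨T', h1, h2⟩ := hT.exists_net (ε := (1 / 2) ^ j) (by linarith) (by positivity)
        (pow_le_one₀ (by norm_num) (by norm_num))
      refine ⟨T', h1.trans (Real.exp_le_exp.2 ?_), fun f hf => ?_, fun h => by omega⟩
      · have hlog : Real.log (4 * N / (1 / 2) ^ j) = (2 + j) * Real.log 2 + Real.log N := by
          rw [Real.log_div (by positivity) (by positivity), Real.log_mul (by norm_num)
            (by linarith), Real.log_pow, one_div, Real.log_inv,
            show (4 : ℝ) = 2 ^ 2 by norm_num, Real.log_pow]
          push_cast; ring
        rw [hlog]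
        have h3 : (2 + (j : ℝ)) * Real.log 2 + Real.log N ≤ (3 + j) * Real.log N := by
          have : (0 : ℝ) ≤ 2 + j := by positivity
          nlinarith
        have h4 : 2 * (d : ℝ) * ((2 + j) * Real.log 2 + Real.log N) ≤
            2 * d * ((3 + j) * Real.log N) := by gcongr
        rw [hL] at hLhalf ⊢
        nlinarith
      · obtain ⟨g, hg, hfg⟩ := h2 f hf
        exact ⟨g, hg, hfg.trans (le_of_eq (by rw [hcardI]; ring))⟩
  choose net hcard hcover hnet0 using hnet
  choose! π hπ hπd using hcover
  -- At level `J` the distance to the net is below `1`, so the approximation is exact.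
  obtain ⟨J, hJ⟩ := exists_pow_lt_of_lt_one (show (0 : ℝ) < 1 / (2 * n) by positivity)
    (show (1 / 2 : ℝ) < 1 by norm_num)
  have hπJ : ∀ f ∈ T, π J f = f := by
    intro f hf
    have h1 := hπd J f hf
    have h2 : 2 * (n : ℝ) * (1 / 2) ^ J < 1 := by
      rw [lt_div_iff₀ (by positivity)] at hJ
      linarith
    have h3 : hammingDist f (π J f) < 1 := by exact_mod_cast h1.trans_lt h2
    exact (eq_of_hammingDist_eq_zero (by omega)).symm
  have hπ0 : ∀ f ∈ T, ∀ σ, signedDiff σ (π 0 f) = 0 := by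
    intro f hf σ
    have := hπ 0 f hf
    rw [hnet0 0 rfl, Finset.mem_singleton] at this
    rw [this]
    simp [signedDiff, halfDiff]
  -- The radius is the triangle inequality `2 n / 2 ^ (j + 1) + 2 n / 2 ^ j`.
  let links : ℕ → Finset ((Fin n ⊕ Fin n → Bool) × (Fin n ⊕ Fin n → Bool)) := fun j =>
    (net (j + 1) ×ˢ net j).filter
      fun p => (hammingDist p.1 p.2 : ℝ) ≤ 6 * n * (1 / 2) ^ (j + 1)
  let bad : ℕ → (Fin n ⊕ Fin n → Bool) × (Fin n ⊕ Fin n → Bool) → Finset (Fin n → Bool) :=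
    fun j p => Finset.univ.filter fun σ =>
      n * (τ / 3 * (3 / 4) ^ (j + 1)) ≤ signedDiff σ p.1 - signedDiff σ p.2
  have hsub : B ⊆ (Finset.range J).biUnion fun j => (links j).biUnion (bad j) := by
    intro σ hσ
    obtain ⟨f, hf, hσf⟩ := hB σ hσ
    by_contra hno
    simp only [Finset.mem_biUnion, not_exists, not_and] at hno
    have hstep : ∀ j ∈ Finset.range J, signedDiff σ (π (j + 1) f) - signedDiff σ (π j f) ≤
        n * (τ / 3 * (3 / 4) ^ (j + 1)) := by
      intro j hj
      have := hno j hj (π (j + 1) f, π j f) (Finset.mem_filter.2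
        ⟨Finset.mem_product.2 ⟨hπ _ f hf, hπ _ f hf⟩, by
          have h1 := hπd (j + 1) f hf
          have h2 := hπd j f hf
          have h3 : (hammingDist (π (j + 1) f) (π j f) : ℝ) ≤
              hammingDist f (π (j + 1) f) + hammingDist f (π j f) := by
            rw [hammingDist_comm f (π (j + 1) f)]
            exact_mod_cast hammingDist_triangle _ _ _
          rw [pow_succ] at h1 ⊢
          dsimp only
          linarith⟩)
      simp only [bad, Finset.mem_filter, Finset.mem_univ, true_and, not_le] at this
      exact this.le
    have htel := Finset.sum_range_sub (fun j => signedDiff σ (π j f)) J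
    rw [hπJ f hf, hπ0 f hf, sub_zero] at htel
    have hle := Finset.sum_le_sum hstep
    rw [htel] at hle
    have hgeom : ∑ j ∈ Finset.range J, n * (τ / 3 * (3 / 4 : ℝ) ^ (j + 1)) ≤ n * τ := by
      have h1 : ∑ j ∈ Finset.range J, n * (τ / 3 * (3 / 4 : ℝ) ^ (j + 1)) =
          n * τ * (1 - (3 / 4 : ℝ) ^ J) := by
        have : ∀ j ∈ Finset.range J, n * (τ / 3 * (3 / 4 : ℝ) ^ (j + 1)) =
            n * τ / 4 * (3 / 4 : ℝ) ^ j := fun j _ => by rw [pow_succ]; ring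
        rw [Finset.sum_congr rfl this, ← Finset.mul_sum, geom_sum_eq (by norm_num)]
        ring
      rw [h1]
      have : 0 ≤ (3 / 4 : ℝ) ^ J := by positivity
      have : 0 < n * τ := by positivity
      nlinarith
    linarith
  have hlinks : ∀ j, ((links j).card : ℝ) ≤ Real.exp (8 * L * (j + 2)) := by
    intro j
    calc ((links j).card : ℝ) ≤ ((net (j + 1) ×ˢ net j).card : ℝ) := by
          exact_mod_cast Finset.card_filter_le _ _
      _ = (net (j + 1)).card * (net j).card := by
          rw [Finset.card_product]; push_cast; rfl
      _ ≤ Real.exp ((7 + 2 * (j + 1 : ℕ)) * L) * Real.exp ((7 + 2 * j) * L) := by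
          gcongr
          · exact hcard _
          · exact hcard _
      _ ≤ _ := by
          rw [← Real.exp_add]
          apply Real.exp_le_exp.2
          push_cast
          have : (0 : ℝ) ≤ j := by positivity
          nlinarith
  -- The number of links and the tail both have exponents linear in `j + 2`, so the hypothesis on
  -- `n` leaves `(δ / 4) ^ (j + 2)`, which is summable over the levels.
  have hterm : ∀ j ∈ Finset.range J, (((links j).biUnion (bad j)).card : ℝ) ≤
      2 ^ n * ((δ / 4) * (1 / 2) ^ (j + 1)) := by
    intro j _
    calc (((links j).biUnion (bad j)).card : ℝ) ≤ ∑ p ∈ links j, ((bad j p).card : ℝ) := by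
          exact_mod_cast Finset.card_biUnion_le
      _ ≤ ∑ p ∈ links j, 2 ^ n * Real.exp (-(n * τ ^ 2 / 1728 * (j + 2))) :=
          Finset.sum_le_sum fun p hp => card_link_le hn hτ j _ _ (Finset.mem_filter.1 hp).2
      _ = 2 ^ n * ((links j).card * Real.exp (-(n * τ ^ 2 / 1728 * (j + 2)))) := by
          rw [Finset.sum_const, nsmul_eq_mul]; ring
      _ ≤ 2 ^ n * (Real.exp (8 * L * (j + 2)) * Real.exp (-(n * τ ^ 2 / 1728 * (j + 2)))) := by
          gcongr; exact hlinks j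
      _ ≤ 2 ^ n * Real.exp (-Real.log (4 / δ) * (j + 2)) := by
          rw [← Real.exp_add]
          gcongr
          have : (0 : ℝ) ≤ j + 2 := by positivity
          nlinarith
      _ = 2 ^ n * ((δ / 4) * (δ / 4) ^ (j + 1)) := by
          have h1 : Real.exp (-Real.log (4 / δ)) = δ / 4 := by
            rw [← Real.log_inv, inv_div, Real.exp_log (by positivity)]
          rw [← pow_succ', ← h1, ← Real.exp_nat_mul]
          congr 2
          push_cast; ring
      _ ≤ _ := by
          gcongr
          linarith
  calc (B.card : ℝ) ≤ (((Finset.range J).biUnion fun j => (links j).biUnion (bad j)).card : ℝ) := by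
        exact_mod_cast Finset.card_le_card hsub
    _ ≤ ∑ j ∈ Finset.range J, (((links j).biUnion (bad j)).card : ℝ) := by
        exact_mod_cast Finset.card_biUnion_le
    _ ≤ ∑ j ∈ Finset.range J, 2 ^ n * ((δ / 4) * (1 / 2 : ℝ) ^ (j + 1)) := Finset.sum_le_sum hterm
    _ = 2 ^ n * (δ / 4) * (1 - (1 / 2 : ℝ) ^ J) := by
        rw [← Finset.mul_sum, ← Finset.mul_sum]
        have : ∀ j ∈ Finset.range J, (1 / 2 : ℝ) ^ (j + 1) = 1 / 2 * (1 / 2 : ℝ) ^ j :=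
          fun j _ => pow_succ' _ _
        rw [Finset.sum_congr rfl this, ← Finset.mul_sum, geom_sum_eq (by norm_num)]
        ring
    _ ≤ 2 ^ n * (δ / 4) := by
        have : 0 ≤ (1 / 2 : ℝ) ^ J := by positivity
        have : 0 ≤ 2 ^ n * (δ / 4) := by positivity
        nlinarith

/-! ### Growth and measurability of the loss over finitely many perturbations. -/

/-- Whether one of finitely many perturbations leads to a misclassification of `z`. -/
def anyError {X : Type u} {k : ℕ} (g : Fin k → X → X) (h : X → Label) (z : X × Label) : Bool :=
  decide (∃ j, h (g j z.1) ≠ z.2)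

/-- Error vectors that differ on `m` examples come from hypotheses that differ on the at most `m *
k` perturbed points, and Sauer–Shelah applies to `H` there. The exponent thus remains `d`, and `k`
enters only through the number of points. -/
lemma hasGrowth_anyError {X : Type u} {H : Set (X → Label)} {d : ℕ}
    (hd : ∀ s : Finset X, Shatters H s → s.card ≤ d) {k : ℕ} (g : Fin k → X → X) {N : ℝ}
    (hN : (k : ℝ) ≤ N) {I : Type*} (S : I → X × Label) :
    HasGrowth {f : I → Bool | ∃ h ∈ H, ∀ i, f i = anyError g h (S i)} d N := by
  classical
  intro m τ T' hT' hinj t ht ht1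
  choose! w hwH hw using hT'
  let A : Finset X := (Finset.univ : Finset (Fin m × Fin k)).image
    fun p => g p.2 (S (τ p.1)).1
  have hA : A.card ≤ m * k := by
    refine Finset.card_image_le.trans ?_
    simp
  have hwinj : Set.InjOn w T' := by
    intro f hf f' hf' he
    ext i
    rw [hw f hf, hw f' hf', he]
  have h := card_mul_pow_le_exp hd A (T'.image w)
    (fun f hf => by
      obtain ⟨f', hf', rfl⟩ := Finset.mem_image.1 hf
      exact hwH f' hf')
    (fun f hf f' hf' hagree => by
      obtain ⟨a, ha, rfl⟩ := Finset.mem_image.1 hf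
      obtain ⟨b, hb, rfl⟩ := Finset.mem_image.1 hf'
      congr 1
      refine hinj ha hb (funext fun l => ?_)
      simp only [Function.comp_apply]
      rw [hw a ha, hw b hb, anyError, anyError]
      congr 1
      refine propext (exists_congr fun j => ?_)
      rw [hagree _ (Finset.mem_image.2 ⟨(l, j), Finset.mem_univ _, rfl⟩)])
    ht ht1
  rw [Finset.card_image_of_injOn hwinj] at h
  refine h.trans (Real.exp_le_exp.2 ?_)
  have h1 : (A.card : ℝ) ≤ m * k := by exact_mod_cast hA
  have h2 : (m : ℝ) * k ≤ m * N := by gcongr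
  exact mul_le_mul_of_nonneg_left (h1.trans h2) ht.le

/-- Relabelling the coordinates of a sample preserves the product measure. -/
lemma measurePreserving_comp_equiv {ι κ Z : Type*} [Fintype ι] [Fintype κ] [MeasurableSpace Z]
    (D : Measure Z) [SigmaFinite D] (e : ι ≃ κ) :
    MeasurePreserving (fun S : κ → Z => S ∘ e) (Measure.pi fun _ => D) (Measure.pi fun _ => D) := by
  have h := measurePreserving_piCongrLeft (fun _ : ι => D) e.symm
  convert h using 1
  ext S i
  simp [MeasurableEquiv.coe_piCongrLeft, Equiv.piCongrLeft_apply]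

/-- The error vector is determined by the label pattern of `h` and the true labels, and there are
only finitely many patterns, so the event is a finite union of pattern events cut by label events.
-/
lemma nullMeasurableSet_exists_anyError {X : Type u} [MeasurableSpace X] {H : Set (X → Label)}
    {G : Set (X → X)} {D : Measure (X × Label)} [IsProbabilityMeasure D]
    (hpat : ∀ (n k : ℕ) (g : Fin k → G) (b : Fin n → Fin k → Label),
      NullMeasurableSet {S : Fin n → X × Label | ∃ h ∈ H, ∀ i j, h ((g j).1 (S i).1) = b i j}
        (Measure.pi fun _ : Fin n => D))
    {k : ℕ} (g : Fin k → G) {ι : Type*} [Fintype ι] (P : (ι → Bool) → Prop) :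
    NullMeasurableSet
      {S : ι → X × Label | ∃ h ∈ H, P fun i => anyError (fun j => (g j).1) h (S i)}
      (Measure.pi fun _ : ι => D) := by
  classical
  have hpat' : ∀ b : ι → Fin k → Label, NullMeasurableSet
      {S : ι → X × Label | ∃ h ∈ H, ∀ i j, h ((g j).1 (S i).1) = b i j}
      (Measure.pi fun _ : ι => D) := by
    intro b
    let e : Fin (Fintype.card ι) ≃ ι := (Fintype.equivFin ι).symm
    have h := (hpat _ k g (fun i => b (e i))).preimage
      (measurePreserving_comp_equiv D e).quasiMeasurePreserving
    convert h using 1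
    ext S
    simp only [Set.mem_ofPred_eq, Set.mem_preimage, Function.comp_apply]
    refine exists_congr fun h => and_congr_right fun _ => ⟨fun h1 i => h1 (e i), fun h1 i => ?_⟩
    simpa using h1 (e.symm i)
  have hlab : ∀ b : ι → Fin k → Label, MeasurableSet
      {S : ι → X × Label | P fun i => decide (∃ j, b i j ≠ (S i).2)} := by
    intro b
    have hm : Measurable fun (S : ι → X × Label) (i : ι) => (S i).2 := by fun_prop
    exact hm (t := {y : ι → Label | P fun i => decide (∃ j, b i j ≠ y i)})
      (Set.toFinite _).measurableSet
  have heq : {S : ι → X × Label | ∃ h ∈ H, P fun i => anyError (fun j => (g j).1) h (S i)} =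
      ⋃ b : ι → Fin k → Label,
        {S : ι → X × Label | ∃ h ∈ H, ∀ i j, h ((g j).1 (S i).1) = b i j} ∩
        {S : ι → X × Label | P fun i => decide (∃ j, b i j ≠ (S i).2)} := by
    ext S
    simp only [Set.mem_ofPred_eq, Set.mem_iUnion, Set.mem_inter_iff]
    constructor
    · rintro ⟨h, hh, hP⟩
      exact ⟨fun i j => h ((g j).1 (S i).1), ⟨h, hh, fun _ _ => rfl⟩, hP⟩
    · rintro ⟨b, ⟨h, hh, hb⟩, hP⟩
      refine ⟨h, hh, ?_⟩
      simpa only [anyError, hb] using hP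
  rw [heq]
  exact NullMeasurableSet.iUnion fun b => (hpat' b).inter (hlab b).nullMeasurableSet

/-! ### Symmetrization and the uniform deviation bound. -/

/-- The permutation that exchanges the two copies of `i` whenever `σ i` is false. -/
def swapPerm {n : ℕ} (σ : Fin n → Bool) : Equiv.Perm (Fin n ⊕ Fin n) :=
  Function.Involutive.toPerm
    (fun x => match x with
      | .inl i => if σ i then .inl i else .inr i
      | .inr i => if σ i then .inr i else .inl i)
    (by rintro (i | i) <;> by_cases h : σ i <;> simp [h])

lemma swapPerm_inl {n : ℕ} (σ : Fin n → Bool) (i : Fin n) :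
    swapPerm σ (.inl i) = if σ i then .inl i else .inr i := rfl

lemma swapPerm_inr {n : ℕ} (σ : Fin n → Bool) (i : Fin n) :
    swapPerm σ (.inr i) = if σ i then .inr i else .inl i := rfl

lemma sum_halfDiff_comp_swapPerm {n : ℕ} (σ : Fin n → Bool) (f : Fin n ⊕ Fin n → Bool) :
    ∑ i, halfDiff (f ∘ swapPerm σ) i = signedDiff σ f := by
  refine Finset.sum_congr rfl fun i _ => ?_
  by_cases h : σ i <;> simp [halfDiff, swapPerm_inl, swapPerm_inr, h]

/-- Tail bound for the symmetrized process of a class of finite VC dimension. -/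
lemma measure_exists_halfDiff_le {X : Type u} [MeasurableSpace X] {H : Set (X → Label)}
    {d : ℕ} (hd : ∀ s : Finset X, Shatters H s → s.card ≤ d) (hd1 : 1 ≤ d)
    {G : Set (X → X)} {D : Measure (X × Label)} [IsProbabilityMeasure D]
    (hpat : ∀ (n k : ℕ) (g : Fin k → G) (b : Fin n → Fin k → Label),
      NullMeasurableSet {S : Fin n → X × Label | ∃ h ∈ H, ∀ i j, h ((g j).1 (S i).1) = b i j}
        (Measure.pi fun _ : Fin n => D))
    {k : ℕ} (g : Fin k → G) {N : ℝ} (hkN : (k : ℝ) ≤ N) (hN : 2 ≤ N) {n : ℕ} (hn : 0 < n)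
    {τ δ : ℝ} (hτ : 0 < τ) (hδ : 0 < δ) (hδ1 : δ < 1)
    (hnτ : 8 * (d * Real.log N) + Real.log (4 / δ) ≤ n * τ ^ 2 / 1728) :
    (Measure.pi fun _ : Fin n ⊕ Fin n => D)
      {S | ∃ h ∈ H, n * τ < ∑ i, halfDiff (fun x => anyError (fun j => (g j).1) h (S x)) i} ≤
      ENNReal.ofReal (δ / 4) := by
  classical
  set μ := Measure.pi fun _ : Fin n ⊕ Fin n => D
  set W : Set (Fin n ⊕ Fin n → X × Label) :=
    {S | ∃ h ∈ H, n * τ < ∑ i, halfDiff (fun x => anyError (fun j => (g j).1) h (S x)) i}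
  have hW : NullMeasurableSet W μ := nullMeasurableSet_exists_anyError hpat g
    fun f => n * τ < ∑ i, halfDiff f i
  have hmp : ∀ σ : Fin n → Bool, MeasurePreserving
      (fun S : Fin n ⊕ Fin n → X × Label => S ∘ swapPerm σ) μ μ :=
    fun σ => measurePreserving_comp_equiv D (swapPerm σ)
  have hWσ : ∀ σ : Fin n → Bool, NullMeasurableSet ((· ∘ swapPerm σ) ⁻¹' W) μ :=
    fun σ => hW.preimage (hmp σ).quasiMeasurePreserving
  -- Every swap preserves the product measure, so `μ W` is the average over all swaps. For each
  -- fixed double sample the chaining bound limits the number of swaps that land in `W`.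
  have hmain : (2 ^ n : ℝ≥0∞) * μ W ≤ 2 ^ n * ENNReal.ofReal (δ / 4) := by
    calc (2 ^ n : ℝ≥0∞) * μ W = ∑ σ : Fin n → Bool, μ ((· ∘ swapPerm σ) ⁻¹' W) := by
          rw [Finset.sum_congr rfl fun σ _ => (hmp σ).measure_preimage hW]
          simp
      _ = ∑ σ : Fin n → Bool, ∫⁻ S, ((· ∘ swapPerm σ) ⁻¹' W).indicator 1 S ∂μ := by
          refine Finset.sum_congr rfl fun σ _ => ?_
          rw [lintegral_indicator_one₀ (hWσ σ)]
      _ = ∫⁻ S, ∑ σ : Fin n → Bool, ((· ∘ swapPerm σ) ⁻¹' W).indicator 1 S ∂μ := by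
          exact (lintegral_finsetSum' _ fun σ _ =>
            aemeasurable_one.indicator₀ (hWσ σ)).symm
      _ ≤ ∫⁻ S, 2 ^ n * ENNReal.ofReal (δ / 4) ∂μ := by
          refine lintegral_mono fun S => ?_
          have hg := hasGrowth_anyError hd (fun j => (g j).1) hkN S
          have hc := hg.card_signedDiff_le hn hd1 hN hτ hδ hδ1 hnτ
            (Finset.univ.filter fun σ : Fin n → Bool => S ∘ swapPerm σ ∈ W) (by
              intro σ hσ
              obtain ⟨h, hh, hlt⟩ := (Finset.mem_filter.1 hσ).2
              refine ⟨fun x => anyError (fun j => (g j).1) h (S x), ⟨h, hh, fun _ => rfl⟩, ?_⟩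
              rw [← sum_halfDiff_comp_swapPerm]
              exact hlt)
          have h2 : ∑ σ : Fin n → Bool, ((· ∘ swapPerm σ) ⁻¹' W).indicator (1 : (Fin n ⊕ Fin n → X × Label) → ℝ≥0∞) S =
              ((Finset.univ.filter fun σ : Fin n → Bool => S ∘ swapPerm σ ∈ W).card : ℝ≥0∞) := by
            rw [Finset.card_filter]
            push_cast
            refine Finset.sum_congr rfl fun σ _ => ?_
            simp [Set.indicator_apply]
          rw [h2, ← ENNReal.ofReal_natCast]
          refine (ENNReal.ofReal_le_ofReal hc).trans ?_
          rw [ENNReal.ofReal_mul (by positivity), ENNReal.ofReal_pow (by norm_num)]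
          simp
      _ = 2 ^ n * ENNReal.ofReal (δ / 4) := by simp [μ]
  exact (ENNReal.mul_le_mul_iff_right (by positivity) (by finiteness)).1 hmain

/-- **Hoeffding's inequality** for the sample mean of a function with values in `[0, 1]`. -/
lemma measure_sum_sub_integral_ge_le {Z : Type*} [MeasurableSpace Z] (D : Measure Z)
    [IsProbabilityMeasure D] {f : Z → ℝ} (hf : AEMeasurable f D) (hf01 : ∀ z, f z ∈ Set.Icc 0 1)
    {n : ℕ} {s : ℝ} (hs : 0 ≤ s) :
    (Measure.pi fun _ : Fin n => D) {S | s ≤ ∑ i, (f (S i) - ∫ z, f z ∂D)} ≤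
      ENNReal.ofReal (Real.exp (-(2 * s ^ 2 / n))) := by
  set μ := Measure.pi fun _ : Fin n => D
  have hind : ProbabilityTheory.iIndepFun
      (fun (i : Fin n) (S : Fin n → Z) => f (S i) - ∫ z, f z ∂D) μ :=
    ProbabilityTheory.iIndepFun_pi (X := fun _ z => f z - ∫ z, f z ∂D)
      fun _ => hf.sub_const _
  have hsub : ∀ i ∈ (Finset.univ : Finset (Fin n)), ProbabilityTheory.HasSubgaussianMGF
      (fun S : Fin n → Z => f (S i) - ∫ z, f z ∂D) ((‖(1 : ℝ) - 0‖₊ / 2) ^ 2) μ := by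
    intro i _
    have hmp := measurePreserving_eval (fun _ : Fin n => D) i
    have h := ProbabilityTheory.hasSubgaussianMGF_of_mem_Icc hf (Filter.Eventually.of_forall hf01)
    exact ProbabilityTheory.HasSubgaussianMGF.of_map hmp.measurable.aemeasurable
      (by rw [hmp.map_eq]; exact h)
  have h := ProbabilityTheory.HasSubgaussianMGF.measure_sum_ge_le_of_iIndepFun hind hsub hs
  rw [Measure.real, ← ENNReal.le_ofReal_iff_toReal_le (by finiteness) (by positivity)] at h
  refine h.trans (ENNReal.ofReal_le_ofReal (Real.exp_le_exp.2 (le_of_eq ?_)))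
  simp only [sub_zero, nnnorm_one, Finset.sum_const, Finset.card_univ, Fintype.card_fin, nsmul_eq_mul]
  rw [neg_div]
  congr 1
  rcases Nat.eq_zero_or_pos n with rfl | hn
  · simp
  · push_cast
    field_simp

/-- The loss of `h` over finitely many perturbations. -/
def anyErrorLoss {X : Type u} {k : ℕ} (g : Fin k → X → X) (h : X → Label) (z : X × Label) : ℝ :=
  if anyError g h z then 1 else 0

lemma anyErrorLoss_mem_Icc {X : Type u} {k : ℕ} (g : Fin k → X → X) (h : X → Label)
    (z : X × Label) : anyErrorLoss g h z ∈ Set.Icc (0 : ℝ) 1 := by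
  unfold anyErrorLoss
  split_ifs <;> simp

lemma aemeasurable_anyErrorLoss {X : Type u} [MeasurableSpace X] {D : Measure (X × Label)}
    {k : ℕ} (g : Fin k → X → X) (h : X → Label)
    (hm : ∀ j, AEMeasurable (fun z : X × Label => h (g j z.1)) D) :
    AEMeasurable (anyErrorLoss g h) D := by
  have h1 : AEMeasurable (fun z : X × Label => ((fun j => h (g j z.1)), z.2)) D :=
    (aemeasurable_pi_lambda _ hm).prodMk measurable_snd.aemeasurable
  exact (measurable_of_countable
    fun p : (Fin k → Label) × Label => (if decide (∃ j, p.1 j ≠ p.2) then 1 else 0 : ℝ)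
    ).comp_aemeasurable h1

/-- Uniform one-sided deviation bound over a class of finite VC dimension, for the loss over
finitely many perturbations. -/
lemma measure_exists_deviation_le {X : Type u} [MeasurableSpace X] {H : Set (X → Label)}
    {d : ℕ} (hd : ∀ s : Finset X, Shatters H s → s.card ≤ d) (hd1 : 1 ≤ d)
    {G : Set (X → X)} {D : Measure (X × Label)} [IsProbabilityMeasure D]
    (hmeas : ∀ h ∈ H, ∀ g ∈ G, AEMeasurable (fun z : X × Label => h (g z.1)) D)
    (hpat : ∀ (n k : ℕ) (g : Fin k → G) (b : Fin n → Fin k → Label),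
      NullMeasurableSet {S : Fin n → X × Label | ∃ h ∈ H, ∀ i j, h ((g j).1 (S i).1) = b i j}
        (Measure.pi fun _ : Fin n => D))
    {k : ℕ} (g : Fin k → G) {N : ℝ} (hkN : (k : ℝ) ≤ N) (hN : 2 ≤ N) {n : ℕ} (hn : 0 < n)
    {τ δ : ℝ} (hτ : 0 < τ) (hδ : 0 < δ) (hδ1 : δ < 1)
    (hnτ : 8 * (d * Real.log N) + Real.log (4 / δ) ≤ n * τ ^ 2 / 1728) :
    (Measure.pi fun _ : Fin n => D)
      {S | ∃ h ∈ H, n * (2 * τ) <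
        ∑ i, (∫ z, anyErrorLoss (fun j => (g j).1) h z ∂D -
          anyErrorLoss (fun j => (g j).1) h (S i))} ≤
      ENNReal.ofReal (δ / 2) := by
  set μ := Measure.pi fun _ : Fin n => D
  set μ₂ := Measure.pi fun _ : Fin n ⊕ Fin n => D
  set B := {S : Fin n → X × Label | ∃ h ∈ H, n * (2 * τ) <
        ∑ i, (∫ z, anyErrorLoss (fun j => (g j).1) h z ∂D -
          anyErrorLoss (fun j => (g j).1) h (S i))}
  set W : Set (Fin n ⊕ Fin n → X × Label) :=
    {S | ∃ h ∈ H, n * τ < ∑ i, halfDiff (fun x => anyError (fun j => (g j).1) h (S x)) i}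
  have hn' : (0 : ℝ) < n := by exact_mod_cast hn
  have hW := measure_exists_halfDiff_le hd hd1 hpat g hkN hN hn hτ hδ hδ1 hnτ
  change μ₂ W ≤ _ at hW
  let e := MeasurableEquiv.sumPiEquivProdPi (fun _ : Fin n ⊕ Fin n => X × Label)
  have hmp : MeasurePreserving e.symm (μ.prod μ) μ₂ :=
    measurePreserving_sumPiEquivProdPi_symm fun _ => D
  -- `W` is only null measurable; a measurable hull of equal measure makes its sections measurable.
  let V := toMeasurable μ₂ W
  have hVm : MeasurableSet (e.symm ⁻¹' V) := e.symm.measurable (measurableSet_toMeasurable μ₂ W)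
  have hVμ : μ.prod μ (e.symm ⁻¹' V) = μ₂ W := by
    rw [hmp.measure_preimage (measurableSet_toMeasurable μ₂ W).nullMeasurableSet,
      measure_toMeasurable]
  -- The hypothesis `h` that is bad on `S` is fixed before the ghost sample is drawn. With
  -- probability at least `1 / 2` its ghost loss falls below the mean by less than `n * τ`, which
  -- leaves a gap of more than `n * τ` between the halves.
  have hhalf : ∀ S ∈ B, 1 / 2 ≤ μ (Prod.mk S ⁻¹' (e.symm ⁻¹' V)) := by
    rintro S ⟨h, hh, hS⟩
    set L := anyErrorLoss (fun j => (g j).1) h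
    have hLm : AEMeasurable L D :=
      aemeasurable_anyErrorLoss _ _ fun j => hmeas h hh _ (g j).2
    have hL01 := anyErrorLoss_mem_Icc (fun j => (g j).1) h
    have hLi : Integrable L D := Integrable.of_mem_Icc 0 1 hLm (Filter.Eventually.of_forall hL01)
    -- Passing to `1 - L` turns the upper tail bound into a lower one.
    have hdev := measure_sum_sub_integral_ge_le D (f := fun z => 1 - L z) (hLm.const_sub 1)
      (fun z => ⟨by linarith [(hL01 z).2], by linarith [(hL01 z).1]⟩) (n := n) (s := n * τ)
      (by positivity)
    have hsmall : Real.exp (-(2 * (n * τ) ^ 2 / n)) ≤ 1 / 2 := by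
      have h1 : 2 * (n * τ) ^ 2 / n = 2 * (n * τ ^ 2) := by field_simp
      have h2 : Real.log 2 ≤ 2 * (n * τ ^ 2) := by
        have h3 : Real.log 2 ≤ Real.log (4 / δ) :=
          Real.log_le_log (by norm_num) (by rw [le_div_iff₀ hδ]; linarith)
        have h4 : 0 ≤ d * Real.log N :=
          mul_nonneg (by positivity) (Real.log_nonneg (by linarith))
        have h5 : 0 ≤ n * τ ^ 2 := by positivity
        linarith
      calc Real.exp (-(2 * (n * τ) ^ 2 / n)) ≤ Real.exp (-Real.log 2) := by
            rw [h1]; exact Real.exp_le_exp.2 (neg_le_neg h2)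
        _ = 1 / 2 := by rw [Real.exp_neg, Real.exp_log (by norm_num)]; norm_num
    have hdev' := hdev.trans (ENNReal.ofReal_le_ofReal hsmall)
    have hcover : (Set.univ : Set (Fin n → X × Label)) ⊆ Prod.mk S ⁻¹' (e.symm ⁻¹' V) ∪
        {S' | n * τ ≤ ∑ i, ((fun z => 1 - L z) (S' i) - ∫ z, (fun z => 1 - L z) z ∂D)} := by
      intro S' _
      by_cases hS' : n * τ ≤ ∑ i, ((fun z => 1 - L z) (S' i) - ∫ z, (fun z => 1 - L z) z ∂D)
      · exact Or.inr hS'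
      · refine Or.inl (subset_toMeasurable μ₂ W ⟨h, hh, ?_⟩)
        have hsum : ∑ i, halfDiff (fun x => anyError (fun j => (g j).1) h (e.symm (S, S') x)) i =
            ∑ i, (∫ z, L z ∂D - L (S i)) -
            ∑ i, ((fun z => 1 - L z) (S' i) - ∫ z, (fun z => 1 - L z) z ∂D) := by
          rw [← Finset.sum_sub_distrib]
          refine Finset.sum_congr rfl fun i _ => ?_
          have h1 : ∫ z, (1 - L z) ∂D = 1 - ∫ z, L z ∂D := by
            rw [integral_sub (integrable_const _) hLi]; simp
          have h2 : halfDiff (fun x => anyError (fun j => (g j).1) h (e.symm (S, S') x)) i =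
            L (S' i) - L (S i) := rfl
          rw [h1, h2]
          ring
        rw [hsum]
        linarith
    have h1 : (1 : ℝ≥0∞) ≤ μ (Prod.mk S ⁻¹' (e.symm ⁻¹' V)) + ENNReal.ofReal (1 / 2) := by
      calc (1 : ℝ≥0∞) = μ Set.univ := by simp [μ]
        _ ≤ _ := (measure_mono hcover).trans (measure_union_le _ _)
        _ ≤ _ := by gcongr
    have h2 : ENNReal.ofReal (1 / 2) = 1 / 2 := by
      rw [ENNReal.ofReal_div_of_pos (by norm_num)]; simp
    rw [h2] at h1
    have h3 := tsub_le_iff_right.2 h1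
    rwa [one_div, ENNReal.one_sub_inv_two, ← one_div] at h3
  -- Markov's inequality for the section measure, then Fubini. `B` need not be measurable, since it
  -- only has to lie in a superlevel set.
  have hmk : (1 / 2 : ℝ≥0∞) * μ B ≤ ENNReal.ofReal (δ / 4) := by
    calc (1 / 2 : ℝ≥0∞) * μ B ≤ 1 / 2 * μ {S | 1 / 2 ≤ μ (Prod.mk S ⁻¹' (e.symm ⁻¹' V))} := by
          gcongr; exact hhalf
      _ ≤ ∫⁻ S, μ (Prod.mk S ⁻¹' (e.symm ⁻¹' V)) ∂μ := mul_meas_ge_le_lintegral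
          (measurable_measure_prodMk_left hVm) _
      _ = μ.prod μ (e.symm ⁻¹' V) := (Measure.prod_apply hVm).symm
      _ ≤ _ := hVμ.le.trans hW
  calc μ B = 2 * (1 / 2 * μ B) := by
        rw [← mul_assoc, one_div, ENNReal.mul_inv_cancel (by norm_num) (by norm_num), one_mul]
    _ ≤ 2 * ENNReal.ofReal (δ / 4) := by gcongr
    _ = ENNReal.ofReal (δ / 2) := by
        rw [← ENNReal.ofReal_ofNat 2, ← ENNReal.ofReal_mul (by norm_num)]
        congr 1; ring

/-! ### Comparison of the robust losses through a finite cover. -/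

lemma robustLoss_mem_Icc {X : Type u} (G : Set (X → X)) (h : X → Label) (z : X × Label) :
    robustLoss G h z ∈ Set.Icc (0 : ℝ) 1 := by
  refine ⟨Real.iSup_nonneg fun g => ?_, Real.iSup_le (fun g => ?_) zero_le_one⟩ <;>
    split_ifs <;> simp

lemma robustLoss_eq_one {X : Type u} {G : Set (X → X)} {h : X → Label} {z : X × Label}
    {g : X → X} (hg : g ∈ G) (hne : h (g z.1) ≠ z.2) : robustLoss G h z = 1 := by
  refine le_antisymm (robustLoss_mem_Icc G h z).2 ?_
  refine le_ciSup_of_le ⟨1, ?_⟩ (⟨g, hg⟩ : G) (by simp [hne])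
  rintro _ ⟨g', rfl⟩
  dsimp only
  split_ifs <;> simp

/-- Includes `G = ∅`, where the real supremum takes its default value `0`. -/
lemma robustLoss_eq_zero {X : Type u} {G : Set (X → X)} {h : X → Label} {z : X × Label}
    (hG : ∀ g ∈ G, h (g z.1) = z.2) : robustLoss G h z = 0 := by
  unfold robustLoss
  have : ∀ g : G, (if h (g.1 z.1) ≠ z.2 then (1 : ℝ) else 0) = 0 := fun g => by
    simp [hG g.1 g.2]
  simp [this]

lemma robustLoss_mono {X : Type u} {G₁ G₂ : Set (X → X)} (hG : G₁ ⊆ G₂) (h : X → Label)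
    (z : X × Label) : robustLoss G₁ h z ≤ robustLoss G₂ h z := by
  by_cases hex : ∃ g ∈ G₁, h (g z.1) ≠ z.2
  · obtain ⟨g, hg, hne⟩ := hex
    rw [robustLoss_eq_one hg hne, robustLoss_eq_one (hG hg) hne]
  · push Not at hex
    rw [robustLoss_eq_zero hex]
    exact (robustLoss_mem_Icc _ _ _).1

lemma anyErrorLoss_le_robustLoss {X : Type u} {G : Set (X → X)} {k : ℕ} (g : Fin k → G)
    (h : X → Label) (z : X × Label) :
    anyErrorLoss (fun j => (g j).1) h z ≤ robustLoss G h z := by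
  unfold anyErrorLoss
  split_ifs with hz
  · obtain ⟨j, hj⟩ := of_decide_eq_true hz
    exact (robustLoss_eq_one (g j).2 hj).ge
  · exact (robustLoss_mem_Icc _ _ _).1

/-- The robust loss over a nice set of perturbations is at most the loss over the centres of a
cover of its enlargement. -/
lemma IsNice.robustLoss_le_anyErrorLoss {X : Type u} {H : Set (X → Label)} {G : Set (X → X)}
    [MetricSpace G] {G' : Set G} {r : ℝ≥0} (hnice : IsNice r H G') {k : ℕ} {g : Fin k → G}
    (hcov : ∀ a ∈ enlargement r G', ∃ j, dist a (g j) ≤ r) {h : X → Label} (hh : h ∈ H)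
    (z : X × Label) :
    robustLoss (Subtype.val '' G') h z ≤ anyErrorLoss (fun j => (g j).1) h z := by
  by_cases hex : ∃ g ∈ Subtype.val '' G', h (g z.1) ≠ z.2
  · obtain ⟨_, ⟨g₀, hg₀, rfl⟩, hne⟩ := hex
    obtain ⟨gs, hgs, hconst⟩ := hnice z.1 h hh g₀ hg₀
    -- The centre to cover is `gs`, not `g₀`: a `g j` within `r` of `gs` lies in the ball on which
    -- `h` is constant, so it errs just as `g₀` does.
    obtain ⟨j, hj⟩ := hcov gs (Set.mem_biUnion hg₀ (by
      rw [Metric.mem_closedBall'] at hgs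
      rw [Metric.mem_closedBall]
      have : (0 : ℝ) ≤ r := r.2
      linarith))
    have hj' := hconst (g j) (by rwa [Metric.mem_closedBall, dist_comm])
    have : anyError (fun j => (g j).1) h z = true := decide_eq_true ⟨j, by rwa [← hj']⟩
    rw [anyErrorLoss, if_pos this]
    exact (robustLoss_mem_Icc _ _ _).2
  · push Not at hex
    rw [robustLoss_eq_zero hex]
    exact (anyErrorLoss_mem_Icc _ _ _).1

lemma exists_cover_of_externalCoveringNumber {E : Type*} [PseudoMetricSpace E] {r : ℝ≥0}
    {A : Set E} {N : ℕ} (hN : Metric.externalCoveringNumber r A = (N : ℕ∞)) :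
    ∃ k ≤ N, ∃ g : Fin k → E, ∀ a ∈ A, ∃ j, dist a (g j) ≤ r := by
  -- The strict bound by `N + 1` extracts a cover from the infimum.
  have hlt : Metric.externalCoveringNumber r A < ((N + 1 : ℕ) : ℕ∞) := by
    rw [hN]; exact_mod_cast Nat.lt_succ_self N
  simp only [Metric.externalCoveringNumber, iInf_lt_iff] at hlt
  obtain ⟨C, hC, hCN⟩ := hlt
  have hfin : C.Finite := Set.finite_of_encard_le_coe hCN.le
  have hcard : C.ncard ≤ N := by
    rw [← hfin.cast_ncard_eq] at hCN
    exact Nat.lt_succ_iff.1 (by exact_mod_cast hCN)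
  have : Finite C := hfin
  let e := Finite.equivFin C
  refine ⟨Nat.card C, hcard, fun j => (e.symm j).1, fun a ha => ?_⟩
  obtain ⟨c, hc, hac⟩ := hC ha
  refine ⟨e ⟨c, hc⟩, ?_⟩
  have hac' : edist a c ≤ r := hac
  rw [edist_dist] at hac'
  simp only [Equiv.symm_apply_apply]
  exact (ENNReal.ofReal_le_iff_le_toReal ENNReal.coe_ne_top).1 hac'

lemma card_le_of_vcDim_eq {X : Type u} {H : Set (X → Label)} {d : ℕ} (hd : vcDim H = (d : ℕ∞))
    (s : Finset X) (hs : Shatters H s) : s.card ≤ d := by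
  have : (s.card : ℕ∞) ≤ vcDim H := le_iSup₂_of_le s hs le_rfl
  rw [hd] at this
  exact_mod_cast this

/-- A class of VC dimension `0` has at most one member. -/
lemma subsingleton_of_vcDim_eq_zero {X : Type u} {H : Set (X → Label)} (hd : vcDim H = 0) :
    H.Subsingleton := by
  intro h₁ hh₁ h₂ hh₂
  by_contra hne
  obtain ⟨x, hx⟩ := Function.ne_iff.1 hne
  have hs : Shatters H {x} := by
    intro y
    by_cases hy : h₁ x = y x
    · exact ⟨h₁, hh₁, by simpa using hy⟩
    · refine ⟨h₂, hh₂, ?_⟩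
      simp only [Finset.mem_singleton, forall_eq]
      revert hx hy
      cases h₁ x <;> cases h₂ x <;> cases y x <;> simp
  have := card_le_of_vcDim_eq (d := 0) (by simpa using hd) _ hs
  simp at this

/-! ### The learning guarantee and the theorem. -/

/-- Robust empirical risk minimization learns tolerantly at the optimal rate. -/
lemma measure_robustRisk_rerm_le {X : Type u} [MeasurableSpace X] {H : Set (X → Label)}
    {G : Set (X → X)} [MetricSpace G] {G' : Set G} {r : ℝ≥0} {d N : ℕ}
    (hnice : IsNice r H G') (hd : vcDim H = (d : ℕ∞))
    (hN : Metric.externalCoveringNumber r (enlargement r G') = (N : ℕ∞))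
    {A : (n : ℕ) → (Fin n → X × Label) → X → Label} (hA : IsRERMRule H G A)
    {D : Measure (X × Label)} [IsProbabilityMeasure D] (hD : RiskMeasurable H G G' D)
    {ε δ : ℝ} (hε : 0 < ε) (hδ : 0 < δ) (hδ1 : δ < 1) {n : ℕ}
    (hn : 276480 * ((d * Real.log (max (N : ℝ) 2) + Real.log (1 / δ)) / ε ^ 2) ≤ n) :
    (Measure.pi fun _ : Fin n => D)
      {S | ¬ robustRisk (Subtype.val '' G') (A n S) D ≤
        (⨅ h : H, robustRisk G h.1 D) + ε} ≤ ENNReal.ofReal δ := by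
  have hint : ∀ h ∈ H, Integrable (robustLoss G h) D := fun h hh =>
    Integrable.of_mem_Icc 0 1 (hD.loss_large h hh)
      (Filter.Eventually.of_forall (robustLoss_mem_Icc G h))
  have hint' : ∀ h ∈ H, Integrable (robustLoss (Subtype.val '' G') h) D := fun h hh =>
    Integrable.of_mem_Icc 0 1 (hD.loss_small h hh)
      (Filter.Eventually.of_forall (robustLoss_mem_Icc _ h))
  have hAH : ∀ S, A n S ∈ H := fun S => (hA n S).1
  have : Nonempty H := ⟨⟨A 0 Fin.elim0, (hA 0 _).1⟩⟩
  rcases Nat.eq_zero_or_pos d with rfl | hd1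
  -- For `d = 0` the term `d log N` cannot absorb constants, but then the only hypothesis is optimal
  -- for every sample.
  · have hsub := subsingleton_of_vcDim_eq_zero (by simpa using hd)
    refine le_of_eq_of_le (measure_mono_null ?_ measure_empty) zero_le
    refine Set.subset_empty_iff.2 <| Set.eq_empty_of_forall_notMem fun S hS => hS ?_
    have h1 : robustRisk (Subtype.val '' G') (A n S) D ≤ robustRisk G (A n S) D :=
      integral_mono (hint' _ (hAH S)) (hint _ (hAH S))
        (robustLoss_mono (by rintro _ ⟨g, -, rfl⟩; exact g.2) _)
    have h2 : robustRisk G (A n S) D ≤ ⨅ h : H, robustRisk G h.1 D :=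
      le_ciInf fun h => by rw [hsub (hAH S) h.2]
    linarith
  set N' : ℝ := max (N : ℝ) 2
  have hN2 : 2 ≤ N' := le_max_right _ _
  set L := d * Real.log N' with hL
  have hd' : (1 : ℝ) ≤ d := by exact_mod_cast hd1
  have hlog2 : Real.log 2 ≤ L := by
    have h1 : Real.log 2 ≤ Real.log N' := Real.log_le_log (by norm_num) hN2
    have h2 : 0 < Real.log 2 := Real.log_pos (by norm_num)
    nlinarith
  have hlog2pos : 0 < Real.log 2 := Real.log_pos (by norm_num)
  have hlδ : 0 < Real.log (1 / δ) := Real.log_pos (by rw [lt_div_iff₀ hδ]; linarith)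
  have hnε : 276480 * (L + Real.log (1 / δ)) ≤ n * ε ^ 2 := by
    rw [← mul_div_assoc, div_le_iff₀ (by positivity)] at hn
    exact hn
  have hn0 : 0 < n := by
    rcases Nat.eq_zero_or_pos n with rfl | h
    · simp only [Nat.cast_zero, zero_mul] at hnε
      linarith
    · exact h
  have hn' : (0 : ℝ) < n := by exact_mod_cast hn0
  obtain ⟨k, hkN, g, hcov⟩ := exists_cover_of_externalCoveringNumber hN
  have hkN' : (k : ℝ) ≤ N' := (Nat.cast_le.2 hkN).trans (le_max_left _ _)
  have hlog4 : Real.log (4 / δ) = 2 * Real.log 2 + Real.log (1 / δ) := by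
    rw [show 4 / δ = 2 ^ 2 * (1 / δ) by ring, Real.log_mul (by norm_num) (by positivity),
      Real.log_pow]
    push_cast; rfl
  -- Since `log (4 / δ) ≤ 2 L + log (1 / δ)`, it suffices that `10 (L + log (1 / δ)) ≤ n (ε / 4) ^ 2
  -- / 1728`, and `276480 = 10 * 16 * 1728`.
  have hdev := measure_exists_deviation_le (card_le_of_vcDim_eq hd) hd1 hD.perturbed hD.pattern g
    hkN' hN2 hn0 (τ := ε / 4) (by positivity) hδ hδ1 (by
      rw [hlog4, div_pow]
      linarith)
  -- The infimum may not be attained. The budget is `ε / 4` for the competitor, `ε / 4` for its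
  -- Hoeffding deviation and `2 * (ε / 4)` for the uniform deviation.
  obtain ⟨⟨h₀, hh₀⟩, hlt⟩ := exists_lt_of_ciInf_lt
    (show ⨅ h : H, robustRisk G h.1 D < (⨅ h : H, robustRisk G h.1 D) + ε / 4 by linarith)
  have hhoef := measure_sum_sub_integral_ge_le D (hD.loss_large h₀ hh₀) (robustLoss_mem_Icc G h₀)
    (n := n) (s := n * (ε / 4)) (by positivity)
  have hsmall : Real.exp (-(2 * (n * (ε / 4)) ^ 2 / n)) ≤ δ / 2 := by
    rw [← Real.le_log_iff_exp_le (by positivity)]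
    have h1 : 2 * (n * (ε / 4)) ^ 2 / n = n * ε ^ 2 / 8 := by field_simp; norm_num
    have h2 : Real.log (δ / 2) = -(Real.log 2 + Real.log (1 / δ)) := by
      rw [← Real.log_mul (by norm_num) (by positivity), ← Real.log_inv]
      congr 1; field_simp
    rw [h1, h2]
    linarith
  have hsub : {S | ¬ robustRisk (Subtype.val '' G') (A n S) D ≤
        (⨅ h : H, robustRisk G h.1 D) + ε} ⊆
      {S | ∃ h ∈ H, n * (2 * (ε / 4)) <
        ∑ i, (∫ z, anyErrorLoss (fun j => (g j).1) h z ∂D -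
          anyErrorLoss (fun j => (g j).1) h (S i))} ∪
      {S : Fin n → X × Label |
        n * (ε / 4) ≤ ∑ i, (robustLoss G h₀ (S i) - ∫ z, robustLoss G h₀ z ∂D)} := by
    intro S hS
    by_contra hno
    simp only [Set.mem_union, Set.mem_ofPred_eq, not_or, not_exists, not_and, not_lt,
      not_le] at hno
    obtain ⟨hno1, hno2⟩ := hno
    refine hS ?_
    have h1 := hno1 (A n S) (hAH S)
    rw [Finset.sum_sub_distrib] at h1 hno2
    simp only [Finset.sum_const, Finset.card_univ, Fintype.card_fin, nsmul_eq_mul] at h1 hno2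
    have h2 : ∑ i, anyErrorLoss (fun j => (g j).1) (A n S) (S i) ≤
        ∑ i, robustLoss G (A n S) (S i) :=
      Finset.sum_le_sum fun i _ => anyErrorLoss_le_robustLoss g _ _
    have h3 : ∑ i, robustLoss G (A n S) (S i) ≤ ∑ i, robustLoss G h₀ (S i) := by
      have := (hA n S).2 h₀ hh₀
      rwa [empiricalRobustRisk, empiricalRobustRisk, div_le_div_iff_of_pos_right hn'] at this
    have h4 : robustRisk (Subtype.val '' G') (A n S) D ≤
        ∫ z, anyErrorLoss (fun j => (g j).1) (A n S) z ∂D :=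
      integral_mono (hint' _ (hAH S))
        (Integrable.of_mem_Icc 0 1
          (aemeasurable_anyErrorLoss _ _ fun j => hD.perturbed _ (hAH S) _ (g j).2)
          (Filter.Eventually.of_forall (anyErrorLoss_mem_Icc _ _)))
        (hnice.robustLoss_le_anyErrorLoss hcov (hAH S))
    have h5 : n * (∫ z, anyErrorLoss (fun j => (g j).1) (A n S) z ∂D) <
        n * (robustRisk G h₀ D + 3 * ε / 4) := by
      change _ - n * robustRisk G h₀ D < _ at hno2
      linarith
    have h6 := lt_of_mul_lt_mul_left h5 hn'.le
    linarith
  calc _ ≤ _ := (measure_mono hsub).trans (measure_union_le _ _)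
    _ ≤ ENNReal.ofReal (δ / 2) + ENNReal.ofReal (δ / 2) :=
        add_le_add hdev (hhoef.trans (ENNReal.ofReal_le_ofReal hsmall))
    _ = ENNReal.ofReal δ := by
        rw [← ENNReal.ofReal_add (by positivity) (by positivity)]
        congr 1; ring

end TolerantRobust

theorem theorem6 :
    (∃ C : ℝ, 0 < C ∧
      ∀ (X : Type u) [MeasurableSpace X] (H : Set (X → TolerantRobust.Label))
        (G : Set (X → X)) [MetricSpace G] (G' : Set G) (r : ℝ≥0) (d N : ℕ),
        TolerantRobust.IsNice r H G' →
        TolerantRobust.vcDim H = (d : ℕ∞) →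
        Metric.externalCoveringNumber r (TolerantRobust.enlargement r G') = (N : ℕ∞) →
        ∀ A : (n : ℕ) → (Fin n → X × TolerantRobust.Label) → X → TolerantRobust.Label,
        TolerantRobust.IsRERMRule H G A →
        ∀ (D : Measure (X × TolerantRobust.Label)) [IsProbabilityMeasure D],
        TolerantRobust.RiskMeasurable H G G' D →
        ∀ ε δ : ℝ, 0 < ε → 0 < δ → δ < 1 →
        ∀ n : ℕ,
        C * ((d * Real.log (max (N : ℝ) 2) + Real.log (1 / δ)) / ε ^ 2) ≤ n →
        (Measure.pi fun _ : Fin n => D)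
          {S | ¬ TolerantRobust.robustRisk (Subtype.val '' G') (A n S) D ≤
            (⨅ h : H, TolerantRobust.robustRisk G h.1 D) + ε} ≤ ENNReal.ofReal δ) ∧
    (∀ (p : ℝ≥0∞) [Fact (1 ≤ p)] (q : ℕ) (b : TolerantRobust.Label) (r : ℝ≥0)
      (G : Set (TolerantRobust.LpSpace p q → TolerantRobust.LpSpace p q)) [MetricSpace G],
      TolerantRobust.translations p q (3 * r) ⊆ G →
      (∀ g g' : G, IsLUB (Set.range fun x => ‖g.1 x - g'.1 x‖) (dist g g')) →
      TolerantRobust.IsNice r (TolerantRobust.halfspaces p q b)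
        {g : G | g.1 ∈ TolerantRobust.translations p q r}) := by
  refine ⟨⟨276480, by norm_num, ?_⟩, ?_⟩
  · intro X _ H G _ G' r d N hnice hd hN A hA D _ hD ε δ hε hδ hδ1 n hn
    exact TolerantRobust.measure_robustRisk_rerm_le hnice hd hN hA hD hε hδ hδ1 hn
  · intro p _ q b r G _ hG hdist
    exact TolerantRobust.isNice_translations p q b r G hG hdist
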